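/- Let $\mathbb K$ be $\mathbb R$ or $\mathbb C$ and let $p\in(0,1]$. A $p$-norm on a $\mathbb K$-vector space $X$ is a function $\|\cdot\|:X\to[0,\infty)$ such that $\|x\|=0$ implies $x=0$, $\|\lambda x\|=|\lambda|\,\|x\|$ and $\|x+y\|^p\le\|x\|^p+\|y\|^p$ for all $x,y\in X$ and $\lambda\in\mathbb K$. A $p$-Banach space is a vector space with a $p$-norm which is complete for the metric $d(x,y)=\|x-y\|^p$; topological notions refer to this metric. An isometry is a linear map $f:X\to Y$ (not necessarily surjective) with $\|f(x)\|=\|x\|$ for all $x\in X$; two spaces are isometric if there is a surjective isometry between them. For $0\le\varepsilon<1$, an $\varepsilon$-isometry is a linear map $f:X\to Y$ with $(1-\varepsilon)\|x\|\le\|f(x)\|\le(1+\varepsilon)\|x\|$ for all $x\in X$. A $p$-Banach space $U$ is of almost universal disposition for finite-dimensional $p$-Banach spaces if for every $\varepsilon\in(0,1)$ and every isometry $g:X\to Y$, where $Y$ is a finite-dimensional $p$-Banach space and $X$ is a linear subspace of $U$ with the restricted $p$-norm, there is an $\varepsilon$-isometry $f:Y\to U$ such that $f(g(x))=x$ for all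 $x\in X$. **Theorem.** For every $p\in(0,1]$ there exists a separable $p$-Banach space $\mathbb G_p$ over $\mathbb K$ of almost universal disposition for finite-dimensional $p$-Banach spaces. It is unique up to isometries: every separable $p$-Banach space over $\mathbb K$ of almost universal disposition for finite-dimensional $p$-Banach spaces is isometric to $\mathbb G_p$. Moreover, for every separable $p$-Banach space $S$ over $\mathbb K$ there is an isometry $S\to\mathbb G_p$. -/

import Mathlib

universe u

/-- `X`, with its norm function `‖·‖` and its metric, is a `p`-normed space over `𝕜`: `‖·‖` is a
`p`-norm, and the metric is the usual one, `dist x y = ‖x - y‖ ^ p`. Its balls at `x` are the sets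
`{y | ‖x - y‖ < r}`, so that for `0 < p` the topology and the uniform structure of `X`
are those given by the quasinorm. -/
class PNormedSpace (p : ℝ) (𝕜 : Type*) [RCLike 𝕜] (X : Type*) [AddCommGroup X] [Module 𝕜 X]
    [Norm X] [MetricSpace X] : Prop where
  pnorm_nonneg : ∀ x : X, 0 ≤ ‖x‖
  eq_zero_of_pnorm_eq_zero : ∀ x : X, ‖x‖ = 0 → x = 0
  pnorm_smul : ∀ (c : 𝕜) (x : X), ‖c • x‖ = ‖c‖ * ‖x‖
  pnorm_add_rpow_le : ∀ x y : X, ‖x + y‖ ^ p ≤ ‖x‖ ^ p + ‖y‖ ^ p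
  dist_eq_rpow : ∀ x y : X, dist x y = ‖x - y‖ ^ p

/-- A `p`-Banach space is a complete `p`-normed space. -/
class PBanachSpace (p : ℝ) (𝕜 : Type*) [RCLike 𝕜] (X : Type*) [AddCommGroup X] [Module 𝕜 X]
    [Norm X] [MetricSpace X] : Prop extends PNormedSpace p 𝕜 X, CompleteSpace X

/-- A linear map `f` is an `ε`-isometry (used for `0 ≤ ε < 1`) if
`(1 - ε) ‖x‖ ≤ ‖f x‖ ≤ (1 + ε) ‖x‖` for all `x`. -/
def IsEpsIsometry {𝕜 X Y : Type*} [RCLike 𝕜] [AddCommGroup X] [Module 𝕜 X] [Norm X]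
    [AddCommGroup Y] [Module 𝕜 Y] [Norm Y] (ε : ℝ) (f : X →ₗ[𝕜] Y) : Prop :=
  ∀ x : X, (1 - ε) * ‖x‖ ≤ ‖f x‖ ∧ ‖f x‖ ≤ (1 + ε) * ‖x‖

/-- `U` is of almost universal disposition for finite-dimensional `p`-Banach spaces: for every
`ε ∈ (0, 1)`, every subspace `X` of `U` and every isometry `g : X → Y` into a finite-dimensional
`p`-Banach space, there is an `ε`-isometry `f : Y → U` with `f (g x) = x` for all `x ∈ X`. -/
def AlmostUniversalDisposition (p : ℝ) (𝕜 : Type) [RCLike 𝕜] (U : Type u) [AddCommGroup U]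
    [Module 𝕜 U] [Norm U] : Prop :=
  ∀ ε : ℝ, 0 < ε → ε < 1 →
    ∀ (X : Submodule 𝕜 U) (Y : Type u) [AddCommGroup Y] [Module 𝕜 Y] [Norm Y] [MetricSpace Y]
      [PBanachSpace p 𝕜 Y] [FiniteDimensional 𝕜 Y] (g : X →ₗ[𝕜] Y),
      (∀ x : X, ‖g x‖ = ‖(x : U)‖) →
      ∃ f : Y →ₗ[𝕜] U, IsEpsIsometry ε f ∧ ∀ x : X, f (g x) = (x : U)

open Filter Topology

/-! ### Fibre infima and amalgamation of seminorms -/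

namespace Seminorm

variable {K A V W Z : Type*} [NormedField K] [AddCommGroup A] [Module K A] [AddCommGroup V]
  [Module K V] [AddCommGroup W] [Module K W] [AddCommGroup Z] [Module K Z]

/-! For `0 < p ≤ 1`, `|·| ^ p` is again an absolute value on `𝕜`, and the `p`-th power of a `p`-norm
is an ordinary norm over the field with this absolute value. So the theorem reduces to the theory of
Gurarii spaces over a locally compact normed field `K`, where convexity plays no role and only
seminorms and their amalgams are used (`Seminorm.exists_amalgam`).

Uniqueness and universality come from Baire category. The seminorms on `E × H` extending both norms
form a compact space. If `H` is Gurarii, then for each `x` and `δ` the couplings putting some `y`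
within `δ` of `x` form an open dense set (`exists_isCoupling_near`). For a generic coupling every
`x` is at distance zero from some `y`, and this relation is the graph of an isometry `E → H`; if `E`
is Gurarii too, the roles can be exchanged and the isometry is onto.

For existence, a generic seminorm on a space of countable dimension solves countably many
approximate extension problems (`exists_generic_seminorm`). Seminorms on `K ^ n` being separable,
these suffice for the completion to be Gurarii (`isGurarii_of_dense`). -/

theorem bddBelow_range_of_fiber (Q : Seminorm K (A × W)) (x : A) :
    BddBelow (Set.range fun w => Q (x, w)) :=
  ⟨0, by rintro _ ⟨w, rfl⟩; exact apply_nonneg _ _⟩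

/-- The infimum of a seminorm along the fibres of a product. -/
noncomputable def fiberInf (Q : Seminorm K (A × W)) : Seminorm K A :=
  Seminorm.ofSMulLE (fun x => ⨅ w, Q (x, w))
    (le_antisymm ((ciInf_le (Q.bddBelow_range_of_fiber 0) 0).trans_eq (map_zero Q))
      (Real.iInf_nonneg fun _ => apply_nonneg _ _))
    (fun x y => by
      refine le_ciInf_add_ciInf fun w w' => ?_
      refine (ciInf_le (Q.bddBelow_range_of_fiber _) (w + w')).trans ?_
      simpa using map_add_le_add Q (x, w) (y, w'))
    (fun c x => by
      rw [Real.mul_iInf_of_nonneg (norm_nonneg c)]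
      refine le_ciInf fun w => (ciInf_le (Q.bddBelow_range_of_fiber _) (c • w)).trans_eq ?_
      simpa using map_smul_eq_mul Q c (x, w))

theorem fiberInf_le (Q : Seminorm K (A × W)) (x : A) (w : W) : Q.fiberInf x ≤ Q (x, w) :=
  ciInf_le (Q.bddBelow_range_of_fiber x) w

theorem le_fiberInf (Q : Seminorm K (A × W)) {x : A} {r : ℝ} (h : ∀ w, r ≤ Q (x, w)) :
    r ≤ Q.fiberInf x :=
  le_ciInf h

/-- Amalgamation of a seminorm `N` on `V` and a seminorm `ρ` on `W × Z` along a map `u : W → V`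
which is isometric up to an error `σ`. -/
theorem exists_amalgam (N : Seminorm K V) (σ : Seminorm K W) (u : W →ₗ[K] V)
    (ρ : Seminorm K (W × Z)) (h : ∀ a, |N (u a) - ρ (a, 0)| ≤ σ a) :
    ∃ M : Seminorm K (V × Z), (∀ v, M (v, 0) = N v) ∧
      ∀ a b, |M (u a, b) - ρ (a, b)| ≤ σ a := by
  let fstVZ : (V × Z) × W →ₗ[K] V :=
    LinearMap.fst K V Z ∘ₗ LinearMap.fst K (V × Z) W - u ∘ₗ LinearMap.snd K (V × Z) W
  let sndVZ : (V × Z) × W →ₗ[K] W × Z :=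
    (LinearMap.snd K (V × Z) W).prod (LinearMap.snd K V Z ∘ₗ LinearMap.fst K (V × Z) W)
  -- The amalgam is `M (v, b) = inf_a N (v - u a) + σ a + ρ (a, b)`: part of `v` may be moved to the
  -- other space through `u`, at cost `σ`. The hypothesis on `σ` is what keeps this from lowering
  -- `N` on `V`.
  let Q : Seminorm K ((V × Z) × W) :=
    N.comp fstVZ + σ.comp (LinearMap.snd K (V × Z) W) + ρ.comp sndVZ
  have hQ : ∀ v b a, Q ((v, b), a) = N (v - u a) + σ a + ρ (a, b) := fun v b a => rfl
  refine ⟨Q.fiberInf, fun v => le_antisymm ?_ ?_, fun a b => abs_sub_le_iff.2 ⟨?_, ?_⟩⟩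
  · have := Q.fiberInf_le (v, 0) 0
    rw [hQ] at this
    simpa [show ((0 : W), (0 : Z)) = 0 from rfl] using this
  · refine Q.le_fiberInf fun a => ?_
    rw [hQ]
    have h1 := (abs_le.1 (h a)).2
    have h2 := map_add_le_add N (v - u a) (u a)
    rw [sub_add_cancel] at h2
    linarith
  · have := Q.fiberInf_le (u a, b) a
    rw [hQ, sub_self, map_zero N] at this
    linarith
  · rw [sub_le_comm]
    refine Q.le_fiberInf fun a' => ?_
    rw [hQ]
    have h1 := (abs_le.1 (h (a - a'))).1
    rw [u.map_sub] at h1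
    have h2 : ρ (a, b) ≤ ρ (a - a', 0) + ρ (a', b) := by
      simpa using map_add_le_add ρ (a - a', 0) (a', b)
    have h3 : σ (a - a') ≤ σ a + σ a' := map_sub_le_add σ _ _
    linarith

theorem exists_eq_mul (q : Seminorm K V) {c : ℝ} (hc : 0 ≤ c) :
    ∃ σ : Seminorm K V, ∀ x, σ x = c * q x :=
  ⟨(Real.toNNReal c) • q, fun x => by
    rw [_root_.smul_apply, NNReal.smul_def, Real.coe_toNNReal c hc, smul_eq_mul]⟩

end Seminorm

/-! ### Gurarii spaces: uniqueness and universality through couplings -/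

/-- `U` is of almost universal disposition for finite-dimensional normed spaces over `K`. -/
def IsGurarii (K : Type*) [NontriviallyNormedField K] (U : Type u) [NormedAddCommGroup U]
    [NormedSpace K U] : Prop :=
  ∀ ε : ℝ, 0 < ε → ∀ (X : Submodule K U) (Y : Type u) [AddCommGroup Y] [Module K Y]
    [FiniteDimensional K Y] (ρ : Seminorm K Y), (∀ y, ρ y = 0 → y = 0) →
    ∀ g : X →ₗ[K] Y, (∀ x, ρ (g x) = ‖(x : U)‖) →
    ∃ f : Y →ₗ[K] U, (∀ y, |‖f y‖ - ρ y| ≤ ε * ρ y) ∧ ∀ x, f (g x) = (x : U)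

/-- A coupling of two normed spaces: a seminorm on the product that extends both norms. -/
structure IsCoupling {K E H : Type*} [NontriviallyNormedField K] [NormedAddCommGroup E]
    [NormedSpace K E] [NormedAddCommGroup H] [NormedSpace K H] (N : Seminorm K (E × H)) :
    Prop where
  left : ∀ x, N (x, 0) = ‖x‖
  right : ∀ y, N (0, y) = ‖y‖

section Coupling

variable {K : Type*} [NontriviallyNormedField K] {E H : Type u} [NormedAddCommGroup E]
  [NormedSpace K E] [NormedAddCommGroup H] [NormedSpace K H]

/-- The density step of the category argument. The finite-dimensional piece of `N₀` that `F` and `x`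
see is almost realised inside `H` by the Gurarii property; amalgamating `E` with `H` along this
realisation gives a coupling close to `N₀` on `F`, in which `x` is close to its image. -/
theorem exists_isCoupling_near (hH : IsGurarii K H) {N₀ : Seminorm K (E × H)}
    (h₀ : IsCoupling N₀) (F : Finset (E × H)) (x : E) {δ : ℝ} (hδ : 0 < δ) :
    ∃ N : Seminorm K (E × H), IsCoupling N ∧ (∀ z ∈ F, |N z - N₀ z| < δ) ∧
      ∃ y, N (x, -y) < δ := by
  classical
  have small : ∀ C : ℝ, ∀ᶠ ε : ℝ in 𝓝[>] 0, ε * C < δ := fun C => by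
    have : Tendsto (fun ε : ℝ => ε * C) (𝓝[>] 0) (𝓝 (0 * C)) :=
      ((continuous_id.mul continuous_const).tendsto 0).mono_left nhdsWithin_le_nhds
    rw [zero_mul] at this
    exact this.eventually_lt_const hδ
  obtain ⟨ε, ⟨⟨hεF, hεx⟩, hε1⟩, hε0⟩ :=
    ((((Finset.eventually_all F).2 fun z _ => small (5 * ‖z.1‖ + N₀ z)).and
      (small (3 * ‖x‖))).and (nhdsWithin_le_nhds (Iio_mem_nhds one_pos)) |>.and
      self_mem_nhdsWithin).exists
  replace hε0 : 0 < ε := hε0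
  replace hε1 : ε < 1 := hε1
  let X : Submodule K E := Submodule.span K (insert x (F.image Prod.fst) : Finset E)
  let Y : Submodule K H := Submodule.span K (F.image Prod.snd : Finset H)
  obtain ⟨τ, hτ⟩ := (normSeminorm K X).exists_eq_mul hε0.le
  -- The term `ε * ‖a‖` makes the seminorm definite, since `N₀` may vanish at nonzero pairs; it does
  -- not change the norm of `Y`.
  let ρ : Seminorm K (X × Y) :=
    N₀.comp (X.subtype.prodMap Y.subtype) + τ.comp (LinearMap.fst K X Y)
  have hρ : ∀ a b, ρ (a, b) = N₀ (a, b) + ε * ‖a‖ := fun a b =>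
    congrArg (N₀ (a, b) + ·) (hτ a)
  have hρ0 : ∀ z, ρ z = 0 → z = 0 := by
    rintro ⟨a, b⟩ h
    rw [hρ] at h
    have h1 := apply_nonneg N₀ ((a : E), (b : H))
    have h2 : ‖a‖ = 0 := by
      have := mul_nonneg hε0.le (norm_nonneg a)
      have h3 : ε * ‖a‖ = 0 := by linarith
      exact (mul_eq_zero.1 h3).resolve_left hε0.ne'
    obtain rfl := norm_eq_zero.1 h2
    have h3 : ‖(b : H)‖ = 0 := by simpa [h₀.right] using h
    have : b = 0 := by simpa using h3
    rw [this]; rfl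
  obtain ⟨f, hf, hfY⟩ := hH ε hε0 Y (X × Y) ρ hρ0 (LinearMap.inr K X Y) fun y => by
    simp [hρ, h₀.right]
  let g : X →ₗ[K] H := f ∘ₗ LinearMap.inl K X Y
  have hfg : ∀ a b, f (a, b) = b + g a := fun a b => by
    have h1 : f (0, b) = b := hfY b
    rw [← h1]
    change _ = _ + f (a, 0)
    rw [← map_add]; simp
  -- The defect of `g` is at most `ε + ε * (1 + ε) ≤ 3 * ε` times `‖a‖`: the perturbation in `ρ`
  -- plus the distortion of `f`.
  obtain ⟨σ, hσ⟩ := (normSeminorm K X).exists_eq_mul (mul_nonneg zero_le_three hε0.le)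
  replace hσ : ∀ a, σ a = 3 * ε * ‖a‖ := hσ
  have hg : ∀ a, |‖a‖ - ‖g a‖| ≤ σ a := fun a => by
    have h1 : |‖g a‖ - (‖a‖ + ε * ‖a‖)| ≤ ε * (‖a‖ + ε * ‖a‖) := by
      have : |‖g a‖ - ρ (a, 0)| ≤ ε * ρ (a, 0) := hf (a, 0)
      rw [hρ] at this
      simpa [h₀.left] using this
    rw [hσ]
    have h2 := abs_le.1 h1
    have h3 : ε * (ε * ‖a‖) ≤ 1 * (ε * ‖a‖) := by gcongr
    have h4 : 0 ≤ ε * ‖a‖ := by positivity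
    rw [abs_le]
    constructor <;> linarith [h2.1, h2.2]
  obtain ⟨M, hM, hM'⟩ := Seminorm.exists_amalgam (normSeminorm K E) σ X.subtype
    ((normSeminorm K H).comp (LinearMap.snd K X H + g ∘ₗ LinearMap.fst K X H)) fun a => by
      simpa using hg a
  replace hM' : ∀ (a : X) b, |M ((a : E), b) - ‖b + g a‖| ≤ 3 * ε * ‖a‖ := fun a b =>
    (hM' a b).trans_eq (hσ a)
  refine ⟨M, ⟨hM, fun y => ?_⟩, fun z hz => ?_, ?_⟩
  · have := hM' 0 y
    simpa [sub_eq_zero] using this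
  · have ha : z.1 ∈ X := Submodule.subset_span (by
      simpa using Or.inr ⟨z.2, hz⟩)
    have hb : z.2 ∈ Y := Submodule.subset_span (by
      simpa using ⟨z.1, hz⟩)
    have h1 := abs_le.1 (hM' ⟨z.1, ha⟩ z.2)
    have h2 := hf (⟨z.1, ha⟩, ⟨z.2, hb⟩)
    rw [hfg, hρ] at h2
    replace h2 := abs_le.1 h2
    simp only [Submodule.coe_norm, Prod.mk.eta] at h1 h2
    refine lt_of_le_of_lt ?_ (hεF z hz)
    have h3 : ε * (ε * ‖z.1‖) ≤ 1 * (ε * ‖z.1‖) := by gcongr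
    have h4 : 0 ≤ ε * ‖z.1‖ := by positivity
    rw [abs_le]
    constructor <;> linarith [h1.1, h1.2, h2.1, h2.2]
  · have ha : x ∈ X := Submodule.subset_span (by simp)
    refine ⟨g ⟨x, ha⟩, ?_⟩
    have h1 := (abs_le.1 (hM' ⟨x, ha⟩ (-g ⟨x, ha⟩))).2
    rw [neg_add_cancel, norm_zero, sub_zero] at h1
    refine h1.trans_lt ?_
    have := hεx
    simp only [Submodule.coe_norm]
    linarith

variable (K E H) in
/-- The couplings of `E` and `H`, as a space of functions with the pointwise topology. -/
def couplings : Set (E × H → ℝ) :=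
  {φ | ∃ N : Seminorm K (E × H), IsCoupling N ∧ ⇑N = φ}

/-- The conditions are closed under pointwise limits, and `N (x, y) ≤ ‖x‖ + ‖y‖` puts all couplings
in a product of compact intervals. -/
theorem isCompact_couplings : IsCompact (couplings K E H) := by
  have hc : IsClosed (couplings K E H) := by
    have : couplings K E H = {φ | (∀ z w, φ (z + w) ≤ φ z + φ w) ∧
        (∀ (c : K) z, φ (c • z) = ‖c‖ * φ z) ∧ (∀ x, φ (x, 0) = ‖x‖) ∧
        ∀ y, φ (0, y) = ‖y‖} := by
      ext φ
      constructor
      · rintro ⟨N, hN, rfl⟩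
        exact ⟨map_add_le_add N, map_smul_eq_mul N, hN.left, hN.right⟩
      · rintro ⟨h1, h2, h3, h4⟩
        exact ⟨Seminorm.of φ h1 h2, ⟨h3, h4⟩, rfl⟩
    rw [this]
    simp only [Set.ofPred_and, Set.ofPred_forall]
    refine IsClosed.inter ?_ (IsClosed.inter ?_ (IsClosed.inter ?_ ?_))
    · exact isClosed_iInter fun z => isClosed_iInter fun w =>
        isClosed_le (by fun_prop) (by fun_prop)
    · exact isClosed_iInter fun z => isClosed_iInter fun w =>
        isClosed_eq (by fun_prop) (by fun_prop)
    · exact isClosed_iInter fun z => isClosed_eq (by fun_prop) (by fun_prop)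
    · exact isClosed_iInter fun z => isClosed_eq (by fun_prop) (by fun_prop)
  refine (isCompact_univ_pi fun z : E × H =>
    isCompact_Icc (a := (0 : ℝ)) (b := ‖z.1‖ + ‖z.2‖)).of_isClosed_subset hc ?_
  rintro _ ⟨N, hN, rfl⟩ ⟨x, y⟩ -
  refine ⟨apply_nonneg N _, ?_⟩
  rw [← hN.left, ← hN.right]
  simpa using map_add_le_add N (x, 0) (0, y)

theorem isOpen_setOf_exists_lt (x : E) (δ : ℝ) :
    IsOpen {φ : couplings K E H | ∃ y, φ.1 (x, -y) < δ} := by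
  simp only [Set.ofPred_exists]
  exact isOpen_iUnion fun y => isOpen_lt
    ((continuous_apply _).comp continuous_subtype_val) continuous_const

theorem dense_of_forall_near {S : Set (couplings K E H)}
    (hS : ∀ N₀ : Seminorm K (E × H), IsCoupling N₀ → ∀ F : Finset (E × H), ∀ δ : ℝ, 0 < δ →
      ∃ φ ∈ S, ∀ z ∈ F, |φ.1 z - N₀ z| < δ) : Dense S := by
  rw [dense_iff_inter_open]
  rintro U hU ⟨⟨_, N₀, hN₀, rfl⟩, hmem⟩
  obtain ⟨O, hO, rfl⟩ := isOpen_induced_iff.1 hU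
  obtain ⟨F, v, hv, hvO⟩ := isOpen_pi_iff.1 hO _ hmem
  have : ∀ᶠ δ : ℝ in 𝓝[>] 0, ∀ z ∈ F, Metric.ball (N₀ z) δ ⊆ v z := by
    refine (Finset.eventually_all F).2 fun z hz => ?_
    obtain ⟨r, hr, hrv⟩ := Metric.isOpen_iff.1 (hv z hz).1 _ (hv z hz).2
    filter_upwards [nhdsWithin_le_nhds (Iio_mem_nhds hr)] with δ hδ
    exact (Metric.ball_subset_ball (le_of_lt hδ)).trans hrv
  obtain ⟨δ, hδ, hδ0⟩ := (this.and self_mem_nhdsWithin).exists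
  obtain ⟨φ, hφ, hφF⟩ := hS N₀ hN₀ F δ hδ0
  exact ⟨φ, hvO fun z hz => hδ z hz (by simpa [Real.dist_eq] using hφF z hz), hφ⟩

theorem dense_setOf_exists_lt (hH : IsGurarii K H) (x : E) {δ : ℝ} (hδ : 0 < δ) :
    Dense {φ : couplings K E H | ∃ y, φ.1 (x, -y) < δ} := by
  refine dense_of_forall_near fun N₀ hN₀ F ε hε => ?_
  obtain ⟨N, hN, hNF, y, hy⟩ := exists_isCoupling_near hH hN₀ F x (lt_min hδ hε)
  exact ⟨⟨N, N, hN, rfl⟩, ⟨y, hy.trans_le (min_le_left _ _)⟩,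
    fun z hz => (hNF z hz).trans_le (min_le_right _ _)⟩

/-- The coupling with the two spaces exchanged. -/
def Seminorm.prodSwap (N : Seminorm K (E × H)) : Seminorm K (H × E) :=
  N.comp (LinearEquiv.prodComm K H E).toLinearMap

theorem Seminorm.prodSwap_apply (N : Seminorm K (E × H)) (x : E) (y : H) :
    N.prodSwap (y, x) = N (x, y) := rfl

theorem IsCoupling.prodSwap {N : Seminorm K (E × H)} (hN : IsCoupling N) :
    IsCoupling N.prodSwap :=
  ⟨hN.right, hN.left⟩

theorem dense_setOf_exists_lt' (hE : IsGurarii K E) (y : H) {δ : ℝ} (hδ : 0 < δ) :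
    Dense {φ : couplings K E H | ∃ x, φ.1 (x, -y) < δ} := by
  classical
  refine dense_of_forall_near fun N₀ hN₀ F ε hε => ?_
  obtain ⟨N, hN, hNF, x, hx⟩ := exists_isCoupling_near hE hN₀.prodSwap (F.image Prod.swap) y
    (lt_min hδ hε)
  refine ⟨⟨N.prodSwap, N.prodSwap, hN.prodSwap, rfl⟩, ⟨x, ?_⟩, fun z hz => ?_⟩
  · change N (-y, x) < δ
    rw [← map_neg_eq_map N, Prod.neg_mk, neg_neg]
    exact hx.trans_le (min_le_left _ _)
  · exact (hNF z.swap (Finset.mem_image_of_mem _ hz)).trans_le (min_le_right _ _)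

theorem exists_isCoupling : ∃ N : Seminorm K (E × H), IsCoupling N :=
  ⟨(normSeminorm K E).comp (LinearMap.fst K E H) + (normSeminorm K H).comp (LinearMap.snd K E H),
    fun x => by simp, fun y => by simp⟩

/-- Near-partners of one `x` are near each other, because `N` restricts to the norm of `H`; so they
form a Cauchy sequence, whose limit is an exact partner. -/
theorem IsCoupling.exists_eq_zero [CompleteSpace H] {N : Seminorm K (E × H)} (hN : IsCoupling N)
    {D : Set E} (hD : Dense D) (h : ∀ x ∈ D, ∀ n : ℕ, ∃ y, N (x, -y) < 1 / (n + 1)) (x : E) :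
    ∃ y, N (x, -y) = 0 := by
  -- The factor `2` pays for replacing `x` by a point of `D`.
  have key : ∀ n : ℕ, ∃ y, N (x, -y) < 2 * (1 / ((n : ℝ) + 1)) := fun n => by
    obtain ⟨x', hx', hd⟩ := Metric.dense_iff.1 hD x (1 / (n + 1)) Nat.one_div_pos_of_nat
    obtain ⟨y, hy⟩ := h x' hd n
    refine ⟨y, ?_⟩
    have h1 : N (x, -y) ≤ N (x - x', 0) + N (x', -y) := by
      simpa using map_add_le_add N (x - x', 0) (x', -y)
    rw [hN.left, ← dist_eq_norm] at h1
    rw [Metric.mem_ball, dist_comm] at hx'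
    linarith
  choose y hy using key
  have hlim : Tendsto (fun n : ℕ => 2 * (1 / ((n : ℝ) + 1))) atTop (𝓝 0) := by
    simpa using tendsto_one_div_add_atTop_nhds_zero_nat.const_mul (2 : ℝ)
  have hdist : ∀ a b : H, ‖a - b‖ ≤ N (x, -a) + N (x, -b) := fun a b => by
    rw [← hN.right]
    have := map_sub_le_add N (x, -b) (x, -a)
    simp only [Prod.mk_sub_mk, sub_self, neg_sub_neg] at this
    linarith
  have hc : CauchySeq y := by
    refine cauchySeq_of_le_tendsto_0 (fun n : ℕ => 2 * (2 * (1 / ((n : ℝ) + 1)))) ?_ ?_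
    · intro n m k hn hm
      rw [dist_eq_norm]
      have h1 : (1 : ℝ) / (n + 1) ≤ 1 / (k + 1) := Nat.one_div_le_one_div hn
      have h2 : (1 : ℝ) / (m + 1) ≤ 1 / (k + 1) := Nat.one_div_le_one_div hm
      linarith [hdist (y n) (y m), hy n, hy m]
    · simpa using hlim.const_mul 2
  obtain ⟨b, hb⟩ := cauchySeq_tendsto_of_complete hc
  refine ⟨b, le_antisymm ?_ (apply_nonneg _ _)⟩
  have hb' : Tendsto (fun n : ℕ => 2 * (1 / ((n : ℝ) + 1)) + ‖y n - b‖) atTop (𝓝 (0 + 0)) :=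
    hlim.add (tendsto_iff_norm_sub_tendsto_zero.1 hb)
  rw [add_zero] at hb'
  refine ge_of_tendsto' hb' fun n => ?_
  have h1 : N (x, -b) ≤ N (x, -y n) + N (0, y n - b) := by
    have := map_add_le_add N (x, -y n) (0, y n - b)
    simpa [← sub_eq_neg_add, sub_eq_add_neg] using this
  rw [hN.right] at h1
  linarith [hy n]

theorem IsCoupling.norm_eq_of_eq_zero {N : Seminorm K (E × H)} (hN : IsCoupling N) {x : E} {y : H}
    (h : N (x, -y) = 0) : ‖y‖ = ‖x‖ := by
  rw [← hN.left, ← hN.right]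
  have h1 : N (x, 0) ≤ N (x, -y) + N (0, y) := by simpa using map_add_le_add N (x, -y) (0, y)
  have h2 : N (0, y) ≤ N (x, 0) + N (x, -y) := by
    simpa using map_sub_le_add N (x, 0) (x, -y)
  linarith

/-- The kernel of a seminorm is a subspace, and here it meets `0 × H` trivially; up to the sign of
`y` it is the graph of a linear map. -/
theorem IsCoupling.exists_linearMap {N : Seminorm K (E × H)} (hN : IsCoupling N)
    (h : ∀ x, ∃ y, N (x, -y) = 0) :
    ∃ f : E →ₗ[K] H, (∀ x, ‖f x‖ = ‖x‖) ∧ ∀ x y, N (x, -y) = 0 → f x = y := by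
  choose f hf using h
  have uniq : ∀ x y, N (x, -y) = 0 → f x = y := fun x y hy => by
    rw [← sub_eq_zero, ← norm_eq_zero, ← hN.right]
    refine le_antisymm ?_ (apply_nonneg _ _)
    have := map_sub_le_add N (x, -y) (x, -f x)
    rw [Prod.mk_sub_mk, sub_self, neg_sub_neg, hy, hf] at this
    linarith
  refine ⟨⟨⟨f, fun x x' => uniq _ _ ?_⟩, fun c x => uniq _ _ ?_⟩,
    fun x => hN.norm_eq_of_eq_zero (hf x), uniq⟩
  · refine le_antisymm ?_ (apply_nonneg _ _)
    have := map_add_le_add N (x, -f x) (x', -f x')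
    rw [hf, hf, Prod.mk_add_mk, ← neg_add] at this
    simpa using this
  · have := map_smul_eq_mul N c (x, -f x)
    rw [hf, mul_zero, Prod.smul_mk, smul_neg] at this
    exact this

/-- Every separable normed space embeds isometrically into a complete Gurarii space. -/
theorem IsGurarii.exists_isometry [CompleteSpace H] [TopologicalSpace.SeparableSpace E]
    (hH : IsGurarii K H) : ∃ f : E →ₗ[K] H, ∀ x, ‖f x‖ = ‖x‖ := by
  have : CompactSpace (couplings K E H) := isCompact_iff_compactSpace.1 isCompact_couplings
  have : Nonempty (couplings K E H) :=
    let ⟨N, hN⟩ := exists_isCoupling (K := K) (E := E) (H := H); ⟨⟨N, N, hN, rfl⟩⟩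
  have hdense := dense_iInter_of_isOpen
    (f := fun i : ℕ × ℕ => {φ : couplings K E H |
      ∃ y, φ.1 (TopologicalSpace.denseSeq E i.1, -y) < 1 / (i.2 + 1 : ℝ)})
    (fun i => isOpen_setOf_exists_lt _ _)
    (fun i => dense_setOf_exists_lt hH _ Nat.one_div_pos_of_nat)
  obtain ⟨⟨_, N, hN, rfl⟩, hφ⟩ := hdense.nonempty
  rw [Set.mem_iInter] at hφ
  obtain ⟨f, hf, -⟩ := hN.exists_linearMap <|
    hN.exists_eq_zero (TopologicalSpace.denseRange_denseSeq E) (by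
      rintro _ ⟨m, rfl⟩ n; exact hφ (m, n))
  exact ⟨f, hf⟩

/-- Two separable complete Gurarii spaces are isometric. -/
theorem IsGurarii.exists_linearEquiv [CompleteSpace E] [CompleteSpace H]
    [TopologicalSpace.SeparableSpace E] [TopologicalSpace.SeparableSpace H]
    (hE : IsGurarii K E) (hH : IsGurarii K H) : ∃ f : E ≃ₗ[K] H, ∀ x, ‖f x‖ = ‖x‖ := by
  have : CompactSpace (couplings K E H) := isCompact_iff_compactSpace.1 isCompact_couplings
  have : Nonempty (couplings K E H) :=
    let ⟨N, hN⟩ := exists_isCoupling (K := K) (E := E) (H := H); ⟨⟨N, N, hN, rfl⟩⟩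
  have hopen' : ∀ (y : H) (δ : ℝ), IsOpen {φ : couplings K E H | ∃ x, φ.1 (x, -y) < δ} := by
    intro y δ
    simp only [Set.ofPred_exists]
    exact isOpen_iUnion fun y => isOpen_lt
      ((continuous_apply _).comp continuous_subtype_val) continuous_const
  -- A single generic coupling meets the requirements in both directions, which replaces a
  -- back-and-forth construction.
  have hdense := dense_iInter_of_isOpen
    (f := fun i : ℕ × ℕ => {φ : couplings K E H |
      ∃ y, φ.1 (TopologicalSpace.denseSeq E i.1, -y) < 1 / (i.2 + 1 : ℝ)} ∩
      {φ | ∃ x, φ.1 (x, -TopologicalSpace.denseSeq H i.1) < 1 / (i.2 + 1 : ℝ)})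
    (fun i => (isOpen_setOf_exists_lt _ _).inter (hopen' _ _))
    (fun i => (dense_setOf_exists_lt hH _ Nat.one_div_pos_of_nat).inter_of_isOpen_left
      (dense_setOf_exists_lt' hE _ Nat.one_div_pos_of_nat) (isOpen_setOf_exists_lt _ _))
  obtain ⟨⟨_, N, hN, rfl⟩, hφ⟩ := hdense.nonempty
  rw [Set.mem_iInter] at hφ
  obtain ⟨f, hf, huniq⟩ := hN.exists_linearMap <|
    hN.exists_eq_zero (TopologicalSpace.denseRange_denseSeq E) (by
      rintro _ ⟨m, rfl⟩ n; exact (hφ (m, n)).1)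
  have hsymm : ∀ x y, N.prodSwap (y, -x) = N (x, -y) := fun x y => by
    rw [Seminorm.prodSwap_apply, ← map_neg_eq_map N, Prod.neg_mk, neg_neg]
  have hsurj : ∀ y, ∃ x, N.prodSwap (y, -x) = 0 :=
    hN.prodSwap.exists_eq_zero (TopologicalSpace.denseRange_denseSeq H) (by
      rintro _ ⟨m, rfl⟩ n
      obtain ⟨x, hx⟩ := (hφ (m, n)).2
      exact ⟨x, by rw [hsymm]; exact hx⟩)
  refine ⟨LinearEquiv.ofBijective f ⟨?_, fun y => ?_⟩, hf⟩
  · rw [← LinearMap.ker_eq_bot, LinearMap.ker_eq_bot']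
    intro x hx
    rw [← norm_eq_zero, ← hf, hx, norm_zero]
  · obtain ⟨x, hx⟩ := hsurj y
    exact ⟨x, huniq x y (by rw [← hsymm]; exact hx)⟩

end Coupling

/-! ### Seminorms on finite-dimensional spaces -/

section FiniteDimensional

variable {K : Type*} [NontriviallyNormedField K]

/-- The seminormed group structure defined by a seminorm. -/
abbrev Seminorm.seminormedGroup {V : Type*} [AddCommGroup V] [Module K V] (N : Seminorm K V) :
    SeminormedAddCommGroup V :=
  AddGroupSeminorm.toSeminormedAddCommGroup N.toAddGroupSeminorm

/-- The normed space structure defined by a seminorm. -/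
abbrev Seminorm.normedSpace {V : Type*} [AddCommGroup V] [Module K V] (N : Seminorm K V) :
    @NormedSpace K V _ N.seminormedGroup :=
  letI := N.seminormedGroup
  { norm_smul_le := fun c x => (map_smul_eq_mul N c x).le }

/-- The normed group structure defined by a definite seminorm. -/
abbrev Seminorm.normedGroup {V : Type*} [AddCommGroup V] [Module K V] (N : Seminorm K V)
    (hN : ∀ x, N x = 0 → x = 0) : NormedAddCommGroup V :=
  AddGroupNorm.toNormedAddCommGroup
    { N.toAddGroupSeminorm with eq_zero_of_map_eq_zero' := fun x => hN x }

/-- The normed space structure defined by a definite seminorm. -/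
abbrev Seminorm.normedGroupNormedSpace {V : Type*} [AddCommGroup V] [Module K V]
    (N : Seminorm K V) (hN : ∀ x, N x = 0 → x = 0) :
    @NormedSpace K V _ (N.normedGroup hN).toSeminormedAddCommGroup :=
  letI := N.normedGroup hN
  { norm_smul_le := fun c x => (map_smul_eq_mul N c x).le }

variable [CompleteSpace K] {P : Type*} [NormedAddCommGroup P] [NormedSpace K P]
  [FiniteDimensional K P]

theorem LinearMap.continuous_norm_comp {Q : Type*} [SeminormedAddCommGroup Q] [NormedSpace K Q]
    (f : P →ₗ[K] Q) : Continuous fun x => ‖f x‖ :=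
  f.continuous_of_finiteDimensional.norm

/-- The identity from `P` to `P` seminormed by `ρ` is linear, hence continuous. -/
theorem Seminorm.continuous_of_finiteDimensional (ρ : Seminorm K P) : Continuous ρ :=
  @LinearMap.continuous_norm_comp K _ _ P _ _ _ P ρ.seminormedGroup ρ.normedSpace LinearMap.id

theorem LinearMap.exists_norm_le_mul {Q : Type*} [NormedAddCommGroup Q] [NormedSpace K Q]
    (f : P →ₗ[K] Q) (hf : Function.Injective f) : ∃ C > 0, ∀ x, ‖x‖ ≤ C * ‖f x‖ := by
  obtain ⟨C, hC, h⟩ := f.exists_antilipschitzWith (LinearMap.ker_eq_bot.2 hf)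
  exact ⟨C, hC, fun x => by simpa using h.le_mul_dist x 0⟩

theorem Seminorm.exists_norm_le_mul (ρ : Seminorm K P) (hρ : ∀ x, ρ x = 0 → x = 0) :
    ∃ C > 0, ∀ x, ‖x‖ ≤ C * ρ x :=
  @LinearMap.exists_norm_le_mul K _ _ P _ _ _ P (ρ.normedGroup hρ) (ρ.normedGroupNormedSpace hρ)
    LinearMap.id Function.injective_id

theorem Seminorm.completeSpace_normedGroup {Y : Type*} [AddCommGroup Y] [Module K Y]
    [FiniteDimensional K Y] (ρ : Seminorm K Y) (hρ : ∀ y, ρ y = 0 → y = 0) :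
    @CompleteSpace Y (ρ.normedGroup hρ).toUniformSpace :=
  let := ρ.normedGroup hρ
  let := ρ.normedGroupNormedSpace hρ
  FiniteDimensional.complete K Y

variable (K P) in
/-- The seminorms of a finite-dimensional space over a locally compact field are separable. -/
theorem exists_seq_seminorm_near [ProperSpace K] :
    ∃ s : ℕ → Seminorm K P, ∀ (ρ : Seminorm K P) (δ : ℝ), 0 < δ →
      ∃ k, ∀ x, |ρ x - s k x| ≤ δ * ‖x‖ := by
  have : ProperSpace P := FiniteDimensional.proper K P
  -- Continuous functions on the compact unit ball form a separable metric space. The dense sequence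
  -- is taken in the range of `Φ`, so that its terms come from seminorms.
  let Φ : Seminorm K P → C(Metric.closedBall (0 : P) 1, ℝ) := fun ρ =>
    ⟨fun x => ρ x, ρ.continuous_of_finiteDimensional.comp continuous_subtype_val⟩
  have : Nonempty (Set.range Φ) := ⟨⟨Φ 0, 0, rfl⟩⟩
  have : CompactSpace (Metric.closedBall (0 : P) 1) :=
    isCompact_iff_compactSpace.1 (isCompact_closedBall 0 1)
  choose s hs using fun k => (TopologicalSpace.denseSeq (Set.range Φ) k).2
  refine ⟨s, fun ρ δ hδ => ?_⟩
  -- The values of the norm of `K` may be discrete, so vectors can be scaled to norm one only up to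
  -- a factor `‖c‖`.
  obtain ⟨c, hc⟩ := NormedField.exists_one_lt_norm K
  have hc0 : 0 < ‖c‖ := one_pos.trans hc
  obtain ⟨k, hk⟩ := (TopologicalSpace.denseRange_denseSeq (Set.range Φ)).exists_dist_lt
    ⟨Φ ρ, ρ, rfl⟩ (div_pos hδ hc0)
  refine ⟨k, fun x => ?_⟩
  rcases eq_or_ne x 0 with rfl | hx
  · simp
  obtain ⟨d, hd, hd1, -, hd2⟩ := rescale_to_shell hc one_pos hx
  have h1 : dist (Φ ρ) (Φ (s k)) ≤ δ / ‖c‖ := by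
    rw [hs]; exact hk.le
  have h2 := (ContinuousMap.dist_le (by positivity)).1 h1 ⟨d • x, by simpa using hd1.le⟩
  change dist (ρ (d • x)) (s k (d • x)) ≤ _ at h2
  rw [Real.dist_eq, map_smul_eq_mul, map_smul_eq_mul, ← mul_sub, abs_mul, abs_norm] at h2
  have hd0 : 0 < ‖d‖ := norm_pos_iff.2 hd
  calc |ρ x - s k x| = ‖d‖⁻¹ * (‖d‖ * |ρ x - s k x|) := by field_simp
    _ ≤ (1⁻¹ * ‖c‖ * ‖x‖) * (δ / ‖c‖) := by gcongr
    _ = δ * ‖x‖ := by field_simp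

end FiniteDimensional

/-! ### A generic seminorm on a space of countable dimension -/

section Generic

variable {K V : Type*} [NontriviallyNormedField K] [AddCommGroup V] [Module K V]

namespace Module.Basis

/-- The span of the first `n` vectors of a basis. -/
def initialSpan (b : Basis ℕ K V) (n : ℕ) : Submodule K V :=
  Submodule.span K (b '' Set.Iio n)

theorem initialSpan_mono (b : Basis ℕ K V) {n m : ℕ} (h : n ≤ m) :
    b.initialSpan n ≤ b.initialSpan m :=
  Submodule.span_mono (Set.image_mono (Set.Iio_subset_Iio h))

theorem mem_initialSpan (b : Basis ℕ K V) {i n : ℕ} (h : i < n) : b i ∈ b.initialSpan n :=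
  Submodule.subset_span ⟨i, h, rfl⟩

theorem exists_mem_initialSpan (b : Basis ℕ K V) (x : V) : ∃ n, x ∈ b.initialSpan n := by
  refine ⟨(b.repr x).support.sup id + 1, ?_⟩
  suffices Finsupp.linearCombination K b (b.repr x) ∈ b.initialSpan _ by
    rwa [b.linearCombination_repr] at this
  refine Submodule.sum_mem _ fun i hi => Submodule.smul_mem _ _ (b.mem_initialSpan ?_)
  exact Nat.lt_succ_of_le (Finset.le_sup (f := id) hi)

theorem exists_forall_mem_initialSpan (b : Basis ℕ K V) {r : ℕ} (u : (Fin r → K) →ₗ[K] V) :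
    ∃ n, ∀ a, u a ∈ b.initialSpan n := by
  choose n hn using fun j : Fin r => b.exists_mem_initialSpan (u (Pi.single j 1))
  refine ⟨Finset.univ.sup n, fun a => ?_⟩
  rw [u.pi_apply_eq_sum_univ a]
  refine Submodule.sum_mem _ fun j _ => Submodule.smul_mem _ _ ?_
  have : (fun i => if j = i then (1 : K) else 0) = Pi.single j 1 := by
    ext i; simp [Pi.single_apply, eq_comm]
  rw [this]
  exact b.initialSpan_mono (Finset.le_sup (Finset.mem_univ j)) (hn j)

/-- Only the values on the first `n` basis vectors' span must be kept, so the next `m` basis vectors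
are free to play the new coordinates. The amalgam is pulled back along `T`, which kills all later
basis vectors. -/
theorem exists_seminorm_extending (b : Basis ℕ K V) (n : ℕ) (N : Seminorm K V) {r m : ℕ}
    (u : (Fin r → K) →ₗ[K] V) (hu : ∀ a, u a ∈ b.initialSpan n)
    (ρ : Seminorm K ((Fin r → K) × (Fin m → K))) {δ : ℝ} (hδ : 0 ≤ δ)
    (h : ∀ a, |N (u a) - ρ (a, 0)| ≤ δ * ‖a‖) :
    ∃ (N' : Seminorm K V) (v : (Fin m → K) →ₗ[K] V), (∀ x ∈ b.initialSpan n, N' x = N x) ∧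
      (∀ a, v a ∈ b.initialSpan (n + m)) ∧
      ∀ a c, |N' (u a + v c) - ρ (a, c)| ≤ δ * ‖a‖ := by
  classical
  obtain ⟨σ, hσ⟩ := (normSeminorm K (Fin r → K)).exists_eq_mul hδ
  replace hσ : ∀ a, σ a = δ * ‖a‖ := hσ
  obtain ⟨M, hM, hM'⟩ := Seminorm.exists_amalgam N σ u ρ fun a => (h a).trans_eq (hσ a).symm
  let T : V →ₗ[K] V × (Fin m → K) := b.constr K fun i =>
    if i < n then (b i, 0) else (0, fun j => if i = n + j then 1 else 0)
  have hT : ∀ x ∈ b.initialSpan n, T x = (x, 0) := by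
    intro x hx
    refine LinearMap.eqOn_span (f := T) (g := LinearMap.inl K V (Fin m → K)) ?_ hx
    rintro _ ⟨i, hi, rfl⟩
    simp [T, Set.mem_Iio.1 hi]
  let v : (Fin m → K) →ₗ[K] V := Fintype.linearCombination K fun j : Fin m => b (n + j)
  have hTv : ∀ c, T (v c) = (0, c) := by
    intro c
    have : T ∘ₗ v = LinearMap.inr K V (Fin m → K) := by
      ext j
      · simp [T, v]
      · simp [T, v, Pi.single_apply, Fin.ext_iff, eq_comm]
    exact LinearMap.congr_fun this c
  refine ⟨M.comp T, v, fun x hx => ?_, fun a => ?_, fun a c => ?_⟩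
  · rw [Seminorm.comp_apply, hT x hx, hM]
  · rw [Fintype.linearCombination_apply]
    exact Submodule.sum_mem _ fun j _ => Submodule.smul_mem _ _ (b.mem_initialSpan (by omega))
  · rw [Seminorm.comp_apply, map_add, hT _ (hu a), hTv, Prod.mk_add_mk, add_zero, zero_add]
    exact (hM' a c).trans_eq (hσ a)

end Module.Basis

/-- A seminorm regarded as prescribed on the span of the first `level` vectors of a basis only. -/
structure SeminormApprox (b : Module.Basis ℕ K V) where
  level : ℕ
  seminorm : Seminorm K V

namespace SeminormApprox

variable {b : Module.Basis ℕ K V}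

instance : Preorder (SeminormApprox b) where
  le p q := p.level ≤ q.level ∧ ∀ x ∈ b.initialSpan p.level, q.seminorm x = p.seminorm x
  le_refl p := ⟨le_rfl, fun _ _ => rfl⟩
  le_trans p q r h h' := ⟨h.1.trans h'.1, fun x hx =>
    (h'.2 x (b.initialSpan_mono h.1 hx)).trans (h.2 x hx)⟩

/-- Any two members of the ideal have a common refinement, so their prescribed values agree and
glue; unbounded levels make the glued seminorm defined everywhere. -/
theorem exists_seminorm_of_ideal (I : Order.Ideal (SeminormApprox b))
    (hI : ∀ n, ∃ p ∈ I, n ≤ p.level) :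
    ∃ N : Seminorm K V, ∀ p ∈ I, ∀ x ∈ b.initialSpan p.level, N x = p.seminorm x := by
  have cover : ∀ x, ∃ p ∈ I, x ∈ b.initialSpan p.level := fun x => by
    obtain ⟨n, hn⟩ := b.exists_mem_initialSpan x
    obtain ⟨p, hp, hnp⟩ := hI n
    exact ⟨p, hp, b.initialSpan_mono hnp hn⟩
  choose P hP hPx using cover
  have key : ∀ p ∈ I, ∀ x ∈ b.initialSpan p.level, (P x).seminorm x = p.seminorm x := by
    intro p hp x hx
    obtain ⟨q, -, hpq, hPq⟩ := I.directed p hp (P x) (hP x)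
    rw [← hpq.2 x hx, ← hPq.2 x (hPx x)]
  refine ⟨Seminorm.of (fun x => (P x).seminorm x) (fun x y => ?_) (fun c x => ?_), key⟩
  · obtain ⟨q, hq, hxq, hyq⟩ := I.directed (P x) (hP x) (P y) (hP y)
    have hx := b.initialSpan_mono hxq.1 (hPx x)
    have hy := b.initialSpan_mono hyq.1 (hPx y)
    rw [key q hq x hx, key q hq y hy, key q hq _ (add_mem hx hy)]
    exact map_add_le_add _ _ _
  · rw [key (P x) (hP x) _ (Submodule.smul_mem _ c (hPx x)), map_smul_eq_mul]

end SeminormApprox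

/-- For countably many finite-dimensional extension problems there is a seminorm that solves
all of them. -/
theorem exists_generic_seminorm (b : Module.Basis ℕ K V) {ι : Type*} [Countable ι] (r m : ι → ℕ)
    (u : ∀ i, (Fin (r i) → K) →ₗ[K] V) (ρ : ∀ i, Seminorm K ((Fin (r i) → K) × (Fin (m i) → K)))
    (δ : ι → ℝ) (hδ : ∀ i, 0 ≤ δ i) :
    ∃ N : Seminorm K V, ∀ i, (∀ a, |N (u i a) - ρ i (a, 0)| ≤ δ i * ‖a‖) →
      ∃ v : (Fin (m i) → K) →ₗ[K] V, ∀ a c, |N (u i a + v c) - ρ i (a, c)| ≤ δ i * ‖a‖ := by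
  -- Both the data and the solution must lie in the prescribed part, so that no refinement can
  -- disturb them.
  let solved : ι → Set (SeminormApprox b) := fun i => {p | (∀ a, u i a ∈ b.initialSpan p.level) ∧
    ((∀ a, |p.seminorm (u i a) - ρ i (a, 0)| ≤ δ i * ‖a‖) →
      ∃ v : (Fin (m i) → K) →ₗ[K] V, (∀ c, v c ∈ b.initialSpan p.level) ∧
        ∀ a c, |p.seminorm (u i a + v c) - ρ i (a, c)| ≤ δ i * ‖a‖)}
  have hsolved : ∀ i, IsCofinal (solved i) := by
    intro i p
    obtain ⟨n, hn⟩ := b.exists_forall_mem_initialSpan (u i)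
    have hu : ∀ a, u i a ∈ b.initialSpan (max n p.level) := fun a =>
      b.initialSpan_mono (le_max_left _ _) (hn a)
    by_cases h : ∀ a, |p.seminorm (u i a) - ρ i (a, 0)| ≤ δ i * ‖a‖
    · obtain ⟨N, v, hN, hv, hNv⟩ :=
        b.exists_seminorm_extending (max n p.level) p.seminorm (u i) hu (ρ i) (hδ i) h
      refine ⟨⟨max n p.level + m i, N⟩, ⟨fun a => b.initialSpan_mono (Nat.le_add_right _ _) (hu a),
        fun _ => ⟨v, hv, hNv⟩⟩, (le_max_right _ _).trans (Nat.le_add_right _ _), fun x hx =>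
        hN x (b.initialSpan_mono (le_max_right _ _) hx)⟩
    -- Raising the level freezes the failure of the hypothesis, and the problem stays vacuous in
    -- every refinement.
    · exact ⟨⟨max n p.level, p.seminorm⟩, ⟨hu, fun h' => absurd h' h⟩, le_max_right _ _,
        fun _ _ => rfl⟩
  have hlevel : ∀ n : ℕ, IsCofinal {p : SeminormApprox b | n ≤ p.level} := fun n p =>
    ⟨⟨max n p.level, p.seminorm⟩, le_max_left n p.level, le_max_right _ _, fun _ _ => rfl⟩
  let := Encodable.ofCountable ι
  let I := Order.idealOfCofinals (⟨0, 0⟩ : SeminormApprox b) (Sum.elim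
    (fun i => (⟨solved i, hsolved i⟩ : Order.Cofinal (SeminormApprox b)))
    (fun n => ⟨_, hlevel n⟩))
  have meets := Order.cofinal_meets_idealOfCofinals (⟨0, 0⟩ : SeminormApprox b) (Sum.elim
    (fun i => (⟨solved i, hsolved i⟩ : Order.Cofinal (SeminormApprox b)))
    (fun n => ⟨_, hlevel n⟩))
  obtain ⟨N, hN⟩ := SeminormApprox.exists_seminorm_of_ideal I fun n =>
    let ⟨p, hp, hpI⟩ := meets (Sum.inr n); ⟨p, hpI, hp⟩
  refine ⟨N, fun i h => ?_⟩
  obtain ⟨p, ⟨hpu, hp⟩, hpI⟩ := meets (Sum.inl i)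
  obtain ⟨v, hv, hpv⟩ := hp fun a => by rw [← hN p hpI _ (hpu a)]; exact h a
  exact ⟨v, fun a c => by rw [hN p hpI _ (add_mem (hpu a) (hv c))]; exact hpv a c⟩

end Generic

/-! ### Existence of a separable complete Gurarii space -/

theorem norm_linearCombination_sub_le {K G : Type*} [NontriviallyNormedField K]
    [NormedAddCommGroup G] [NormedSpace K G] {r : ℕ} {x y : Fin r → G} {η : ℝ}
    (h : ∀ j, ‖x j - y j‖ ≤ η) (a : Fin r → K) :
    ‖Fintype.linearCombination K x a - Fintype.linearCombination K y a‖ ≤ r * η * ‖a‖ := by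
  rw [Fintype.linearCombination_apply, Fintype.linearCombination_apply, ← Finset.sum_sub_distrib]
  refine (norm_sum_le_of_le (f := fun j => a j • x j - a j • y j) (n := fun _ => ‖a‖ * η)
    Finset.univ fun j _ => ?_).trans_eq ?_
  · rw [← smul_sub, norm_smul]
    exact mul_le_mul (norm_le_pi_norm a j) (h j) (norm_nonneg _) (norm_nonneg _)
  · rw [Finset.sum_const, Finset.card_univ, Fintype.card_fin, nsmul_eq_mul]
    ring

/-- Countably many approximate extension properties, with data from dense families, suffice for
a normed space to be of almost universal disposition. -/
theorem isGurarii_of_dense {K : Type*} [NontriviallyNormedField K] [CompleteSpace K]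
    {G : Type u} [NormedAddCommGroup G] [NormedSpace K G]
    {J : Type*} {d : J → G} (hd : DenseRange d)
    {s : ∀ r m : ℕ, ℕ → Seminorm K ((Fin r → K) × (Fin m → K))}
    (hs : ∀ (r m : ℕ) (ρ : Seminorm K ((Fin r → K) × (Fin m → K))) (δ : ℝ), 0 < δ →
      ∃ k, ∀ x, |ρ x - s r m k x| ≤ δ * ‖x‖)
    (H : ∀ (r m : ℕ) (c : Fin r → J) (k l : ℕ),
      (∀ a, |‖Fintype.linearCombination K (d ∘ c) a‖ - s r m k (a, 0)| ≤
        1 / ((l : ℝ) + 1) * ‖a‖) →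
      ∃ v : (Fin m → K) →ₗ[K] G, ∀ a b,
        |‖Fintype.linearCombination K (d ∘ c) a + v b‖ - s r m k (a, b)| ≤
          1 / ((l : ℝ) + 1) * ‖a‖) :
    IsGurarii K G := by
  intro ε hε X Y _ _ _ ρ hρ g hg
  have hginj : Function.Injective g := by
    rw [← LinearMap.ker_eq_bot, LinearMap.ker_eq_bot']
    intro x hx
    have := hg x
    rw [hx, map_zero] at this
    simpa using this.symm
  have : FiniteDimensional K X := FiniteDimensional.of_injective g hginj
  obtain ⟨C, hC⟩ := (LinearMap.range g).exists_isCompl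
  let bx := Module.finBasis K X
  let bc := Module.finBasis K C
  set r := Module.finrank K X
  set m := Module.finrank K C
  let e : ((Fin r → K) × (Fin m → K)) ≃ₗ[K] Y :=
    ((bx.equivFun.symm.trans (LinearEquiv.ofInjective g hginj)).prodCongr bc.equivFun.symm).trans
      (Submodule.prodEquivOfIsCompl _ _ hC)
  have he : ∀ a, e (a, 0) = g (bx.equivFun.symm a) := fun a => by
    simp [e]
  let x : Fin r → G := fun j => bx j
  have hx : ∀ a, ((bx.equivFun.symm a : X) : G) = Fintype.linearCombination K x a := fun a => by
    simp [Module.Basis.equivFun_symm_apply, Fintype.linearCombination_apply, x]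
  let ρ₀ : Seminorm K ((Fin r → K) × (Fin m → K)) := ρ.comp e.toLinearMap
  have hρ₀ : ∀ a, ρ₀ (a, 0) = ‖Fintype.linearCombination K x a‖ := fun a => by
    rw [← hx, ← hg, ← he]; rfl
  obtain ⟨B, hB, hBρ⟩ := ρ₀.exists_norm_le_mul fun z hz => by
    simpa using hρ (e z) hz
  -- The total error will be `2 * δ * ‖(a, b)‖`: `δ / 2` for moving the basis into the dense family,
  -- `δ / 2` for replacing `ρ₀` by some `s r m k`, and `δ` from `H`.
  obtain ⟨l, hl⟩ := exists_nat_one_div_lt (show 0 < ε / (2 * B) by positivity)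
  set δ : ℝ := 1 / ((l : ℝ) + 1) with hδdef
  have hδ : 0 < δ := Nat.one_div_pos_of_nat
  obtain ⟨k, hk⟩ := hs r m ρ₀ (δ / 2) (half_pos hδ)
  have hη : 0 < δ / 2 / (r + 1) := by positivity
  choose c hc using fun j => hd.exists_dist_lt (x j) hη
  have hxc : ∀ a : Fin r → K, ‖Fintype.linearCombination K x a -
      Fintype.linearCombination K (d ∘ c) a‖ ≤ δ / 2 * ‖a‖ := fun a => by
    refine (norm_linearCombination_sub_le (fun j => ?_) a).trans
      (mul_le_mul_of_nonneg_right (?_ : r * (δ / 2 / (r + 1)) ≤ _) (norm_nonneg a))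
    · rw [← dist_eq_norm]; exact (hc j).le
    · rw [mul_div_assoc', div_le_iff₀ (by positivity)]
      nlinarith
  obtain ⟨v, hv⟩ := H r m c k l fun a => by
    have h1 := (abs_norm_sub_norm_le _ _).trans (hxc a)
    have h2 := hk (a, 0)
    rw [hρ₀, Prod.norm_mk, norm_zero, max_eq_left (norm_nonneg a)] at h2
    rw [abs_le] at *
    constructor <;> linarith [h1.1, h1.2, h2.1, h2.2]
  -- The true vectors `x` are used, not their approximations `d ∘ c`, so that `f (g x) = x` holds
  -- exactly.
  let f₀ : (Fin r → K) × (Fin m → K) →ₗ[K] G := (Fintype.linearCombination K x).coprod v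
  refine ⟨f₀ ∘ₗ e.symm.toLinearMap, fun y => ?_, fun w => ?_⟩
  · obtain ⟨⟨a, b⟩, rfl⟩ := e.surjective y
    have hf : (f₀ ∘ₗ e.symm.toLinearMap) (e (a, b)) = Fintype.linearCombination K x a + v b := by
      simp [f₀]
    rw [hf]
    change |_ - ρ₀ (a, b)| ≤ ε * ρ₀ (a, b)
    have h1 : |‖Fintype.linearCombination K x a + v b‖ -
        ‖Fintype.linearCombination K (d ∘ c) a + v b‖| ≤ δ / 2 * ‖a‖ :=
      (abs_norm_sub_norm_le _ _).trans (by rw [add_sub_add_right_eq_sub]; exact hxc a)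
    have h2 := hv a b
    have h3 := hk (a, b)
    have h4 : ‖a‖ ≤ ‖(a, b)‖ := norm_fst_le (a, b)
    have h5 : δ * ‖a‖ ≤ δ * ‖(a, b)‖ := by gcongr
    have h6 : δ * ‖(a, b)‖ ≤ ε / (2 * B) * (B * ρ₀ (a, b)) :=
      mul_le_mul hl.le (hBρ _) (norm_nonneg _) (by positivity)
    have h7 : ε / (2 * B) * (B * ρ₀ (a, b)) = ε * ρ₀ (a, b) / 2 := by field_simp
    rw [abs_le] at *
    constructor <;> linarith [h1.1, h1.2, h2.1, h2.2, h3.1, h3.2]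
  · have : g w = e (bx.equivFun w, 0) := by rw [he, LinearEquiv.symm_apply_apply]
    rw [this]
    simp only [LinearMap.comp_apply, LinearEquiv.coe_coe, LinearEquiv.symm_apply_apply, f₀,
      LinearMap.coprod_apply, map_zero, add_zero]
    rw [← hx, LinearEquiv.symm_apply_apply]

theorem Module.Basis.denseRange_linearCombination {K V : Type*} [NontriviallyNormedField K]
    [SeminormedAddCommGroup V] [NormedSpace K V] (b : Module.Basis ℕ K V) {κ : ℕ → K}
    (hκ : DenseRange κ) :
    DenseRange fun j : Σ n : ℕ, Fin n → ℕ =>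
      Fintype.linearCombination K (fun i : Fin j.1 => b i) (κ ∘ j.2) := by
  intro x
  obtain ⟨n, hn⟩ := b.exists_mem_initialSpan x
  let L : (Fin n → K) →ₗ[K] V := Fintype.linearCombination K fun i : Fin n => b i
  have hx : x ∈ LinearMap.range L := by
    rw [Fintype.range_linearCombination]
    refine Submodule.span_mono ?_ hn
    rintro _ ⟨i, hi, rfl⟩
    exact ⟨⟨i, hi⟩, rfl⟩
  obtain ⟨a, rfl⟩ := hx
  have ha : a ∈ closure (Set.range (Pi.map fun _ : Fin n => κ)) :=
    DenseRange.piMap (fun _ => hκ) a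
  refine closure_mono ?_ (image_closure_subset_closure_image L.continuous_on_pi ⟨a, ha, rfl⟩)
  rintro _ ⟨_, ⟨t, rfl⟩, rfl⟩
  exact ⟨⟨n, t⟩, rfl⟩

/-- The space is the completion of finitely supported sequences under the generic seminorm. The
problems use vectors with coordinates in a countable dense subset of `K`, seminorms from the dense
sequences, and tolerances `1 / (l + 1)`. -/
theorem exists_isGurarii (K : Type) [NontriviallyNormedField K] [ProperSpace K] :
    ∃ (G : Type u) (_ : NormedAddCommGroup G) (_ : NormedSpace K G),
      CompleteSpace G ∧ TopologicalSpace.SeparableSpace G ∧ IsGurarii K G := by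
  let V : Type u := ULift.{u} (ℕ →₀ K)
  let b : Module.Basis ℕ K V := .ofRepr ULift.moduleEquiv
  let κ := TopologicalSpace.denseSeq K
  have hκ : DenseRange κ := TopologicalSpace.denseRange_denseSeq K
  let J := Σ n : ℕ, Fin n → ℕ
  let d : J → V := fun j => Fintype.linearCombination K (fun i : Fin j.1 => b i) (κ ∘ j.2)
  choose s hs using fun r m : ℕ => exists_seq_seminorm_near K ((Fin r → K) × (Fin m → K))
  obtain ⟨N, hN⟩ := exists_generic_seminorm b
    (ι := Σ r : ℕ, ℕ × (Fin r → J) × ℕ × ℕ) (fun i => i.1) (fun i => i.2.1)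
    (fun i => Fintype.linearCombination K (d ∘ i.2.2.1))
    (fun i => s i.1 i.2.1 i.2.2.2.1) (fun i => 1 / ((i.2.2.2.2 : ℝ) + 1))
    fun i => Nat.one_div_pos_of_nat.le
  -- `N` need not be definite; its kernel disappears in the Hausdorff completion.
  let := N.seminormedGroup
  let := N.normedSpace
  let φ : V →ₗᵢ[K] UniformSpace.Completion V := UniformSpace.Completion.toComplₗᵢ
  have hφ : ∀ {r : ℕ} (c : Fin r → J) (a : Fin r → K),
      Fintype.linearCombination K ((φ ∘ d) ∘ c) a =
        φ (Fintype.linearCombination K (d ∘ c) a) := fun c a => by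
    simp [Fintype.linearCombination_apply]
  have hdense : DenseRange (φ ∘ d) :=
    UniformSpace.Completion.denseRange_coe.comp (b.denseRange_linearCombination hκ)
      (UniformSpace.Completion.continuous_coe V)
  refine ⟨UniformSpace.Completion V, inferInstance, inferInstance, inferInstance,
    ⟨Set.range (φ ∘ d), Set.countable_range _, hdense⟩,
    isGurarii_of_dense hdense hs fun r m c k l h => ?_⟩
  obtain ⟨v, hv⟩ := hN ⟨r, m, c, k, l⟩ fun a => by
    have := h a
    rw [hφ, φ.norm_map] at this
    exact this
  refine ⟨φ.toLinearMap ∘ₗ v, fun a b' => ?_⟩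
  rw [hφ]
  change |‖φ _ + φ (v b')‖ - _| ≤ _
  rw [← map_add, φ.norm_map]
  exact hv a b'

/-! ### From `p`-norms to norms by taking `p`-th powers -/

theorem NormedSpace.norm_smul_eq {K : Type*} [NontriviallyNormedField K] {Y : Type*}
    [NormedAddCommGroup Y] [NormedSpace K Y] (c : K) (y : Y) : ‖c • y‖ = ‖c‖ * ‖y‖ :=
  norm_smul c y

section PowNorm

theorem Real.add_rpow_le_of_le {x y z p : ℝ} (hx : 0 ≤ x) (hy : 0 ≤ y) (hz : 0 ≤ z)
    (h : z ≤ x + y) (hp0 : 0 < p) (hp1 : p ≤ 1) : z ^ p ≤ x ^ p + y ^ p :=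
  (Real.rpow_le_rpow hz h hp0.le).trans (Real.rpow_add_le_add_rpow hx hy hp0.le hp1)

variable (𝕜 : Type*) [RCLike 𝕜] {p : ℝ}

/-- The field `𝕜` with the absolute value `‖·‖ ^ p`. -/
noncomputable abbrev powNormedField (hp0 : 0 < p) (hp1 : p ≤ 1) : NontriviallyNormedField 𝕜 where
  toField := inferInstance
  norm x := ‖x‖ ^ p
  dist x y := ‖x - y‖ ^ p
  dist_self x := by simp [hp0.ne']
  dist_comm x y := by rw [norm_sub_rev]
  dist_triangle x y z := Real.add_rpow_le_of_le (norm_nonneg _) (norm_nonneg _) (norm_nonneg _)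
    (norm_sub_le_norm_sub_add_norm_sub x y z) hp0 hp1
  eq_of_dist_eq_zero {x y} h :=
    sub_eq_zero.1 (norm_eq_zero.1 ((Real.rpow_eq_zero (norm_nonneg _) hp0.ne').1 h))
  dist_eq x y := by
    change _ = ‖-x + y‖ ^ p
    rw [norm_sub_rev, sub_eq_neg_add]
  norm_mul x y := by
    change ‖x * y‖ ^ p = ‖x‖ ^ p * ‖y‖ ^ p
    rw [norm_mul, Real.mul_rpow (norm_nonneg _) (norm_nonneg _)]
  non_trivial := ⟨2, Real.one_lt_rpow (by simp) hp0⟩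

/-- Such a map is continuous and carries closed balls onto closed balls. It serves to show that `𝕜`
stays locally compact under `|·| ^ p`. -/
theorem ProperSpace.of_surjective_of_dist_eq_rpow {A B : Type*} [PseudoMetricSpace A]
    [PseudoMetricSpace B] [ProperSpace A] {f : A → B} (hf : f.Surjective) (hp0 : 0 < p)
    (h : ∀ x y, dist (f x) (f y) = dist x y ^ p) : ProperSpace B := by
  have hcont : Continuous f := by
    rw [continuous_iff_continuousAt]
    intro x
    rw [ContinuousAt, tendsto_iff_dist_tendsto_zero]
    simp only [h]
    have : Filter.Tendsto (fun y => dist y x ^ p) (nhds x) (nhds (dist x x ^ p)) :=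
      ((continuous_id.dist continuous_const).tendsto x).rpow_const (Or.inr hp0.le)
    simpa [hp0.ne'] using this
  refine ⟨fun b r => ?_⟩
  obtain ⟨a, rfl⟩ := hf b
  rcases lt_or_ge r 0 with hr | hr
  · rw [Metric.closedBall_eq_empty.2 hr]; exact isCompact_empty
  · have : Metric.closedBall (f a) r = f '' Metric.closedBall a (r ^ p⁻¹) := by
      ext y
      obtain ⟨x, rfl⟩ := hf y
      have key : ∀ z, dist (f z) (f a) ≤ r ↔ dist z a ≤ r ^ p⁻¹ := fun z => by
        rw [h, Real.le_rpow_inv_iff_of_pos dist_nonneg hr hp0]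
      rw [Metric.mem_closedBall, Set.mem_image]
      refine ⟨fun hx => ⟨x, (key x).1 hx, rfl⟩, ?_⟩
      rintro ⟨z, hz, hzx⟩
      rw [← hzx]
      exact (key z).2 hz
    rw [this]
    exact (isCompact_closedBall _ _).image hcont

theorem properSpace_powNormedField (hp0 : 0 < p) (hp1 : p ≤ 1) :
    @ProperSpace 𝕜 (powNormedField 𝕜 hp0 hp1).toPseudoMetricSpace :=
  @ProperSpace.of_surjective_of_dist_eq_rpow p 𝕜 𝕜 _
    (powNormedField 𝕜 hp0 hp1).toPseudoMetricSpace _ id Function.surjective_id hp0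
    fun x y => by rw [dist_eq_norm x y]; rfl

variable {𝕜} (X : Type*) [AddCommGroup X] [Module 𝕜 X] [Norm X] [MetricSpace X]

variable (𝕜) in
/-- A `p`-normed space with the norm `‖·‖ ^ p`. -/
noncomputable abbrev PNormedSpace.powNormedGroup [PNormedSpace p 𝕜 X] :
    NormedAddCommGroup X where
  norm x := ‖x‖ ^ p
  dist_eq x y := by
    change _ = ‖-x + y‖ ^ p
    rw [dist_comm, PNormedSpace.dist_eq_rpow (p := p) (𝕜 := 𝕜) y x, sub_eq_neg_add]

/-- A `p`-normed space over `𝕜` is a normed space for the absolute value `‖·‖ ^ p` of `𝕜`. -/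
noncomputable abbrev PNormedSpace.powNormedSpace [PNormedSpace p 𝕜 X] (hp0 : 0 < p)
    (hp1 : p ≤ 1) :
    @NormedSpace 𝕜 X (powNormedField 𝕜 hp0 hp1).toNormedField
      (PNormedSpace.powNormedGroup 𝕜 X (p := p)).toSeminormedAddCommGroup :=
  @NormedSpace.mk 𝕜 X (powNormedField 𝕜 hp0 hp1).toNormedField
    (PNormedSpace.powNormedGroup 𝕜 X (p := p)).toSeminormedAddCommGroup ‹Module 𝕜 X›
    fun c x => by
      change ‖c • x‖ ^ p ≤ ‖c‖ ^ p * ‖x‖ ^ p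
      rw [PNormedSpace.pnorm_smul (p := p), Real.mul_rpow (norm_nonneg c)
        (PNormedSpace.pnorm_nonneg p 𝕜 x)]

variable {X}

/-- The way back: the `p⁻¹`-th power of the norm is a `p`-norm with the same metric. -/
theorem pBanachSpace_of_normedSpace (hp0 : 0 < p) (hp1 : p ≤ 1) {Y : Type*}
    [i : NormedAddCommGroup Y] (n : @NormedSpace 𝕜 Y (powNormedField 𝕜 hp0 hp1).toNormedField _)
    [CompleteSpace Y] :
    @PBanachSpace p 𝕜 _ Y _ n.toModule ⟨fun y => ‖y‖ ^ p⁻¹⟩ i.toMetricSpace :=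
  @PBanachSpace.mk p 𝕜 _ Y _ n.toModule ⟨fun y => ‖y‖ ^ p⁻¹⟩ i.toMetricSpace
    (@PNormedSpace.mk p 𝕜 _ Y _ n.toModule ⟨fun y => ‖y‖ ^ p⁻¹⟩ i.toMetricSpace
      (fun x => Real.rpow_nonneg (norm_nonneg x) _)
      (fun x hx => norm_eq_zero.1 ((Real.rpow_eq_zero (norm_nonneg x) (inv_pos.2 hp0).ne').1 hx))
      (fun c x => by
        let := n.toModule
        have h : ‖c • x‖ = ‖c‖ ^ p * ‖x‖ :=
          @NormedSpace.norm_smul_eq 𝕜 (powNormedField 𝕜 hp0 hp1) Y i n c x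
        change ‖c • x‖ ^ p⁻¹ = ‖c‖ * ‖x‖ ^ p⁻¹
        rw [h, Real.mul_rpow (Real.rpow_nonneg (norm_nonneg c) _) (norm_nonneg x),
          Real.rpow_rpow_inv (norm_nonneg c) hp0.ne'])
      (fun x y => by
        change (‖x + y‖ ^ p⁻¹) ^ p ≤ (‖x‖ ^ p⁻¹) ^ p + (‖y‖ ^ p⁻¹) ^ p
        simp only [Real.rpow_inv_rpow (norm_nonneg _) hp0.ne']
        exact norm_add_le x y)
      (fun x y => by
        change dist x y = (‖x - y‖ ^ p⁻¹) ^ p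
        rw [Real.rpow_inv_rpow (norm_nonneg _) hp0.ne', dist_eq_norm]))
    ‹_›

end PowNorm

/-! ### Comparison of the two forms of almost universal disposition -/

section Disposition

variable {𝕜 : Type} [RCLike 𝕜] {p : ℝ}

/-- Since `p ≤ 1`, taking `p`-th powers moves `1 - ε` and `1 + ε` towards `1`, so the same `ε`
serves. -/
theorem Real.abs_rpow_sub_le {a r ε : ℝ} (hp0 : 0 < p) (hp1 : p ≤ 1) (ha : 0 ≤ a) (hr : 0 ≤ r)
    (hε0 : 0 < ε) (hε1 : ε < 1) (h1 : (1 - ε) * r ^ p⁻¹ ≤ a) (h2 : a ≤ (1 + ε) * r ^ p⁻¹) :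
    |a ^ p - r| ≤ ε * r := by
  have hr' : 0 ≤ r ^ p⁻¹ := Real.rpow_nonneg hr _
  have hε : 0 ≤ 1 - ε := by linarith
  have h3 := Real.rpow_le_rpow (mul_nonneg hε hr') h1 hp0.le
  have h4 := Real.rpow_le_rpow ha h2 hp0.le
  rw [Real.mul_rpow hε hr', Real.rpow_inv_rpow hr hp0.ne'] at h3
  rw [Real.mul_rpow (by linarith) hr', Real.rpow_inv_rpow hr hp0.ne'] at h4
  have h5 : 1 - ε ≤ (1 - ε) ^ p := by
    simpa using Real.rpow_le_rpow_of_exponent_ge (x := 1 - ε) (by linarith) (by linarith) hp1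
  have h6 : (1 + ε) ^ p ≤ 1 + ε := by
    simpa using Real.rpow_le_rpow_of_exponent_le (by linarith) hp1
  have h7 := mul_le_mul_of_nonneg_right h5 hr
  have h8 := mul_le_mul_of_nonneg_right h6 hr
  rw [abs_le]
  constructor <;> linarith

/-- Taking roots enlarges distortion, so here the tolerance must shrink, by an amount depending on
`p`. -/
theorem Real.exists_forall_abs_sub_rpow_le {ε : ℝ} (hp0 : 0 < p) (hε0 : 0 < ε) (hε1 : ε < 1) :
    ∃ η > 0, ∀ b r : ℝ, 0 ≤ b → 0 ≤ r → |b - r ^ p| ≤ η * r ^ p →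
      (1 - ε) * r ≤ b ^ p⁻¹ ∧ b ^ p⁻¹ ≤ (1 + ε) * r := by
  have h1 : (1 - ε) ^ p < 1 := Real.rpow_lt_one (by linarith) (by linarith) hp0
  have h2 : 1 < (1 + ε) ^ p := Real.one_lt_rpow (by linarith) hp0
  refine ⟨min (1 - (1 - ε) ^ p) ((1 + ε) ^ p - 1), lt_min (by linarith) (by linarith),
    fun b r hb hr h => ?_⟩
  have hrp := Real.rpow_nonneg hr p
  have h3 := mul_le_mul_of_nonneg_right (min_le_left (1 - (1 - ε) ^ p) ((1 + ε) ^ p - 1)) hrp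
  have h4 := mul_le_mul_of_nonneg_right (min_le_right (1 - (1 - ε) ^ p) ((1 + ε) ^ p - 1)) hrp
  rw [abs_le] at h
  rw [Real.le_rpow_inv_iff_of_pos (mul_nonneg (by linarith) hr) hb hp0,
    Real.rpow_inv_le_iff_of_pos hb (mul_nonneg (by linarith) hr) hp0,
    Real.mul_rpow (by linarith) hr, Real.mul_rpow (by linarith) hr]
  constructor <;> linarith [h.1, h.2]

theorem AlmostUniversalDisposition.isGurarii (hp0 : 0 < p) (hp1 : p ≤ 1) {H : Type u}
    [AddCommGroup H] [Module 𝕜 H] [Norm H] [MetricSpace H] [PNormedSpace p 𝕜 H]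
    (hH : AlmostUniversalDisposition p 𝕜 H) :
    @IsGurarii 𝕜 (powNormedField 𝕜 hp0 hp1) H (PNormedSpace.powNormedGroup 𝕜 H (p := p))
      (PNormedSpace.powNormedSpace H hp0 hp1) := by
  intro ε hε X Y _ _ _ ρ hρ g hg
  let iY : NormedAddCommGroup Y := @Seminorm.normedGroup 𝕜 (powNormedField 𝕜 hp0 hp1) Y _ _ ρ hρ
  let nY := @Seminorm.normedGroupNormedSpace 𝕜 (powNormedField 𝕜 hp0 hp1) Y _ _ ρ hρ
  have : CompleteSpace Y := @Seminorm.completeSpace_normedGroup 𝕜 (powNormedField 𝕜 hp0 hp1)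
    (@complete_of_proper 𝕜 (powNormedField 𝕜 hp0 hp1).toPseudoMetricSpace
      (properSpace_powNormedField 𝕜 hp0 hp1)) Y _ _ _ ρ hρ
  let normY : Norm Y := ⟨fun y => ρ y ^ p⁻¹⟩
  have hYB : @PBanachSpace p 𝕜 _ Y _ nY.toModule normY iY.toMetricSpace :=
    pBanachSpace_of_normedSpace hp0 hp1 nY
  -- `IsGurarii` allows every positive `ε`, the original notion only `ε < 1`.
  have hε' : 0 < min ε (1 / 2) := lt_min hε (by norm_num)
  have hε1 : min ε (1 / 2) < 1 := (min_le_right _ _).trans_lt (by norm_num)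
  obtain ⟨f, hf, hfg⟩ := @hH _ hε' hε1 X Y _ nY.toModule normY iY.toMetricSpace hYB ‹_› g
    fun x => by
      change ρ (g x) ^ p⁻¹ = _
      rw [hg x]
      exact Real.rpow_rpow_inv (PNormedSpace.pnorm_nonneg p 𝕜 _) hp0.ne'
  refine ⟨f, fun y => ?_, hfg⟩
  have hy := hf y
  have hfy : 0 ≤ ‖f y‖ := PNormedSpace.pnorm_nonneg p 𝕜 _
  have hρy : 0 ≤ ρ y := @norm_nonneg Y iY.toSeminormedAddCommGroup.toSeminormedAddGroup y
  change |‖f y‖ ^ p - ρ y| ≤ ε * ρ y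
  exact (Real.abs_rpow_sub_le hp0 hp1 hfy hρy hε' hε1 hy.1 hy.2).trans
    (mul_le_mul_of_nonneg_right (min_le_left _ _) hρy)

theorem IsGurarii.almostUniversalDisposition (hp0 : 0 < p) (hp1 : p ≤ 1) {G : Type u}
    [i : NormedAddCommGroup G] (n : @NormedSpace 𝕜 G (powNormedField 𝕜 hp0 hp1).toNormedField _)
    (hG : @IsGurarii 𝕜 (powNormedField 𝕜 hp0 hp1) G i n) :
    @AlmostUniversalDisposition p 𝕜 _ G _ n.toModule ⟨fun x => ‖x‖ ^ p⁻¹⟩ := by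
  intro ε hε hε1 X Y _ _ _ _ _ _ g hg
  obtain ⟨η, hη, key⟩ := Real.exists_forall_abs_sub_rpow_le hp0 hε hε1
  let ρ := @normSeminorm 𝕜 Y (powNormedField 𝕜 hp0 hp1).toNormedField
    (PNormedSpace.powNormedGroup 𝕜 Y (p := p)).toSeminormedAddCommGroup
    (PNormedSpace.powNormedSpace Y hp0 hp1)
  have hρ : ∀ y, ρ y = ‖y‖ ^ p := fun _ => rfl
  obtain ⟨f, hf, hfg⟩ := @hG η hη X Y _ _ _ ρ
    (fun y hy => PNormedSpace.eq_zero_of_pnorm_eq_zero p 𝕜 y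
      ((Real.rpow_eq_zero (PNormedSpace.pnorm_nonneg p 𝕜 y) hp0.ne').1 hy)) g
    (fun x => by
      rw [hρ, hg]
      exact Real.rpow_inv_rpow (norm_nonneg _) hp0.ne')
  refine ⟨f, fun y => ?_, hfg⟩
  exact key ‖f y‖ ‖y‖ (norm_nonneg _) (PNormedSpace.pnorm_nonneg p 𝕜 y) (hf y)

end Disposition

/-! ### The main theorem -/

theorem theorem2p1 {𝕜 : Type} [RCLike 𝕜] (p : ℝ) (hp0 : 0 < p) (hp1 : p ≤ 1) :
    ∃ (G : Type u) (_ : AddCommGroup G) (_ : Module 𝕜 G) (_ : Norm G) (_ : MetricSpace G),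
      PBanachSpace p 𝕜 G ∧ TopologicalSpace.SeparableSpace G ∧
      AlmostUniversalDisposition p 𝕜 G ∧
      (∀ (H : Type u) [AddCommGroup H] [Module 𝕜 H] [Norm H] [MetricSpace H]
        [PBanachSpace p 𝕜 H] [TopologicalSpace.SeparableSpace H],
        AlmostUniversalDisposition p 𝕜 H → ∃ f : G ≃ₗ[𝕜] H, ∀ x : G, ‖f x‖ = ‖x‖) ∧
      (∀ (S : Type u) [AddCommGroup S] [Module 𝕜 S] [Norm S] [MetricSpace S]
        [PBanachSpace p 𝕜 S] [TopologicalSpace.SeparableSpace S],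
        ∃ f : S →ₗ[𝕜] G, ∀ x : S, ‖f x‖ = ‖x‖) := by
  obtain ⟨G, i, n, hGc, hGs, hG⟩ := @exists_isGurarii.{u} 𝕜 (powNormedField 𝕜 hp0 hp1)
    (properSpace_powNormedField 𝕜 hp0 hp1)
  refine ⟨G, i.toAddCommGroup, n.toModule, ⟨fun x => ‖x‖ ^ p⁻¹⟩, i.toMetricSpace,
    pBanachSpace_of_normedSpace hp0 hp1 n, hGs, hG.almostUniversalDisposition hp0 hp1 n, ?_, ?_⟩
  · intro H _ _ _ _ _ _ hH
    obtain ⟨f, hf⟩ := @IsGurarii.exists_linearEquiv 𝕜 (powNormedField 𝕜 hp0 hp1) G H i n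
      (PNormedSpace.powNormedGroup 𝕜 H (p := p)) (PNormedSpace.powNormedSpace H hp0 hp1)
      hGc (PBanachSpace.toCompleteSpace p 𝕜) hGs ‹_› hG (hH.isGurarii hp0 hp1)
    refine ⟨f, fun x => ?_⟩
    have h : ‖f x‖ ^ p = i.norm x := hf x
    change ‖f x‖ = i.norm x ^ p⁻¹
    rw [← h, Real.rpow_rpow_inv (PNormedSpace.pnorm_nonneg p 𝕜 _) hp0.ne']
  · intro S _ _ _ _ _ _
    obtain ⟨f, hf⟩ := @IsGurarii.exists_isometry 𝕜 (powNormedField 𝕜 hp0 hp1) S G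
      (PNormedSpace.powNormedGroup 𝕜 S (p := p)) (PNormedSpace.powNormedSpace S hp0 hp1) i n
      hGc ‹_› hG
    refine ⟨f, fun x => ?_⟩
    have h : i.norm (f x) = ‖x‖ ^ p := hf x
    change i.norm (f x) ^ p⁻¹ = ‖x‖
    rw [h, Real.rpow_rpow_inv (PNormedSpace.pnorm_nonneg p 𝕜 _) hp0.ne']
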